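/- Let $L$ be a compact Lie group and let $I$ be a set (finite or infinite). Write $\mathbb N^{(I)}$ for the finitely supported families of natural numbers indexed by $I$. Let $V=\bigoplus_{\underline n\in\mathbb N^{(I)}}V_{\underline n}$ be a multigraded complex representation of $L$: each $V_{\underline n}$ is an $L$-stable finite-dimensional subspace on which $L$ acts continuously, and $V_{\underline 0}=0$. Let $V_0$ (even) and $V_1$ (odd) be two copies of $V$, and let $$\mathbb K[V_0\oplus V_1]=S(V_0)\otimes\bigwedge V_1$$ be the super-symmetric algebra, with $L$ acting by algebra automorphisms that extend its action on $V_0$ and $V_1$. For $\underline n,\underline m\in\mathbb N^{(I)}$ and $p\in\mathbb Z/2$ let $\mathbb K_{\underline n,\underline m,p}$ be the span of the products $v_1\cdots v_a\otimes w_1\wedge\cdots\wedge w_b$ of homogeneous elements $v_i\in V_0$, $w_j\in V_1$ for which the degrees of the $v_i$ add up to $\underline n$, the degrees of the $w_j$ add up to $\underline m$, and the number $b$ of fermionic factors is congruent to $p$ modulo $2$. Put $\mathbb K^L_{\underline n,\underline m,p}=\mathbb K_{\underline n,\underline m,p}\cap\mathbb K[V_0\oplus V_1]^L$. Then all the spaces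 $\mathbb K^L_{\underline n,\underline m,p}$ are finite-dimensional, and the index of the invariant algebra $$\mathcal I(\mathbb K[V_0\oplus V_1]^L)=\sum_{\underline n,\underline m}\bigl(\dim\mathbb K^L_{\underline n,\underline m,0}-\dim\mathbb K^L_{\underline n,\underline m,1}\bigr)\,t^{\underline n}u^{\underline m}\in\mathbb Z[[t_i,u_i : i\in I]]$$ becomes $1$ after setting $t=u$ (that is, $u_i=t_i$ for all $i\in I$): $$\mathcal I(\mathbb K[V_0\oplus V_1]^L)\big|_{u=t}=1 .$$ -/

import Mathlib

open scoped TensorProduct ContDiff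

/-- The super-symmetric algebra `𝕂(V₀ ⊕ V₁) = S(V₀) ⊗ ⋀ V₁` of a complex superspace `V₀ ⊕ V₁`.
The factor `S(V₀)` is purely even, so that the graded tensor product of algebras is the
ordinary one. -/
abbrev SuperSym (V₀ V₁ : Type*) [AddCommGroup V₀] [Module ℂ V₀] [AddCommGroup V₁] [Module ℂ V₁] :=
  SymmetricAlgebra ℂ V₀ ⊗[ℂ] ExteriorAlgebra ℂ V₁

namespace SuperSym

section grading

variable {ι V₀ V₁ : Type*} [AddCommGroup V₀] [Module ℂ V₀] [AddCommGroup V₁] [Module ℂ V₁]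

/-- The piece of `𝕂(V₀ ⊕ V₁)` of bosonic multidegree `n`, fermionic multidegree `m` and parity `p`.
It is spanned by the products `v₁ ⋯ v_a ⊗ w₁ ∧ ⋯ ∧ w_b` of homogeneous elements where the degrees
of the `v`'s add up to `n`, those of the `w`'s add up to `m`, and the number `b` of fermionic
factors is congruent to `p` modulo 2. -/
noncomputable def component (𝒱₀ : (ι →₀ ℕ) → Submodule ℂ V₀) (𝒱₁ : (ι →₀ ℕ) → Submodule ℂ V₁)
    (n m : ι →₀ ℕ) (p : ZMod 2) : Submodule ℂ (SuperSym V₀ V₁) :=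
  Submodule.span ℂ
    {x | ∃ (a b : ℕ) (d : Fin a → ι →₀ ℕ) (e : Fin b → ι →₀ ℕ) (v : Fin a → V₀) (w : Fin b → V₁),
      (∀ r, v r ∈ 𝒱₀ (d r)) ∧ (∀ s, w s ∈ 𝒱₁ (e s)) ∧
      ∑ r, d r = n ∧ ∑ s, e s = m ∧ (b : ZMod 2) = p ∧
      x = (∏ r, SymmetricAlgebra.ι ℂ V₀ (v r)) ⊗ₜ[ℂ] ExteriorAlgebra.ιMulti ℂ b w}

end grading

section action

variable {L V : Type*} [Group L] [AddCommGroup V] [Module ℂ V]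

/-- The action of a group element on `𝕂(V ⊕ V)`, both copies of `V` carrying the representation
`ρ`, by algebra endomorphisms extending `ρ g` on the generators. -/
noncomputable def act (ρ : Representation ℂ L V) (g : L) : SuperSym V V →ₐ[ℂ] SuperSym V V :=
  Algebra.TensorProduct.map
    (SymmetricAlgebra.lift (SymmetricAlgebra.ι ℂ V ∘ₗ ρ g)) (ExteriorAlgebra.map (ρ g))

/-- The invariant algebra `𝕂(V ⊕ V)^L`. -/
noncomputable def invariants (ρ : Representation ℂ L V) : Subalgebra ℂ (SuperSym V V) :=
  ⨅ g : L, AlgHom.equalizer (act ρ g) (AlgHom.id ℂ (SuperSym V V))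

/-- The piece of `𝕂(V ⊕ V)^L` of bosonic multidegree `n`, fermionic multidegree `m` and
parity `p`. -/
noncomputable def invComponent {ι : Type*} (𝒱 : (ι →₀ ℕ) → Submodule ℂ V)
    (ρ : Representation ℂ L V) (n m : ι →₀ ℕ) (p : ZMod 2) : Submodule ℂ (SuperSym V V) :=
  component 𝒱 𝒱 n m p ⊓ Subalgebra.toSubmodule (invariants ρ)

end action

end SuperSym

/-- The index `∑_{n,m} (dim W_{n,m,even} - dim W_{n,m,odd}) t^n u^m` of a multigraded superspace.
The variables `t_i` are `X (Sum.inl i)` and the variables `u_i` are `X (Sum.inr i)`. -/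
noncomputable def superIndex {ι W : Type*} [AddCommGroup W] [Module ℂ W]
    (𝒲 : (ι →₀ ℕ) → (ι →₀ ℕ) → ZMod 2 → Submodule ℂ W) : MvPowerSeries (ι ⊕ ι) ℤ :=
  fun c ↦
    let n := (Finsupp.sumFinsuppEquivProdFinsupp c).1
    let m := (Finsupp.sumFinsuppEquivProdFinsupp c).2
    (Module.finrank ℂ (𝒲 n m 0) : ℤ) - (Module.finrank ℂ (𝒲 n m 1) : ℤ)

instance tendstoCofinite_sumElim_id (ι : Type*) :
    Filter.TendstoCofinite (Sum.elim id id : ι ⊕ ι → ι) := by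
  rw [Filter.tendstoCofinite_iff_finite_preimage_singleton]
  intro i
  refine ((Set.finite_singleton (Sum.inl i)).union (Set.finite_singleton (Sum.inr i))).subset ?_
  rintro (x | x) hx <;> simp_all

/-- The substitution `t = u`, sending both `t_i` and `u_i` to the same variable. -/
noncomputable def identifyVars (ι : Type*) : MvPowerSeries (ι ⊕ ι) ℤ →ₐ[ℤ] MvPowerSeries ι ℤ :=
  MvPowerSeries.rename (Sum.elim id id)

/-! Let D be the odd derivation of S(V) ⊗ ⋀V with D(even v) = odd v and D(odd v) = even v. Its
square is an ordinary derivation that fixes every generator, so D² multiplies a product of k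
generators by k. D preserves the total degree N = n + m, flips parity and commutes with L. For N ≠ 0
every spanning product has at least one factor, so D² has only nonzero eigenvalues and D is
injective. Hence D embeds the invariants of degree N and parity p into those of parity p + 1; since
p is arbitrary, the dimensions agree. For N = 0 only the constants remain, because V has no
degree-zero part.

Setting u = t sums the dimensions over n + m = N. To read this sum as the dimension of one space of
invariants, the pieces with n + m = N must be independent (`iSupIndep_component`). The other pillars
are `koszul_koszul_mul`, `act_koszul` and `eq_zero_of_koszul_eq_zero`. -/

namespace SuperSym

/-! ### Generators and a triangular matrix model of the derivation -/

section koszul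

variable {V : Type*} [AddCommGroup V] [Module ℂ V]

/-- The even generator attached to `v`. -/
noncomputable def even : V →ₗ[ℂ] SuperSym V V :=
  (Algebra.TensorProduct.includeLeft :
    SymmetricAlgebra ℂ V →ₐ[ℂ] SuperSym V V).toLinearMap ∘ₗ SymmetricAlgebra.ι ℂ V

/-- The odd generator attached to `w`. -/
noncomputable def odd : V →ₗ[ℂ] SuperSym V V :=
  (Algebra.TensorProduct.includeRight :
    ExteriorAlgebra ℂ V →ₐ[ℂ] SuperSym V V).toLinearMap ∘ₗ ExteriorAlgebra.ι ℂ

theorem even_apply (v : V) :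
    even v = SymmetricAlgebra.ι ℂ V v ⊗ₜ[ℂ] (1 : ExteriorAlgebra ℂ V) := rfl

theorem odd_apply (w : V) :
    odd w = (1 : SymmetricAlgebra ℂ V) ⊗ₜ[ℂ] ExteriorAlgebra.ι ℂ w := rfl

theorem even_mul_even (v w : V) : even v * even w = even w * even v := by
  simp [even_apply, mul_comm]

theorem even_mul_odd (v w : V) : even v * odd w = odd w * even v := by
  simp [even_apply, odd_apply]

theorem odd_mul_self (v : V) : odd v * odd v = 0 := by
  simp [odd_apply]

theorem odd_mul_odd (v w : V) : odd v * odd w = -(odd w * odd v) := by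
  have h := odd_mul_self (v + w)
  simp only [map_add, add_mul, mul_add, odd_mul_self, zero_add, add_zero] at h
  exact eq_neg_of_add_eq_zero_right h

protected theorem neg_mul (x y : SuperSym V V) : -x * y = -(x * y) :=
  eq_neg_of_add_eq_zero_left (by rw [← add_mul, neg_add_cancel, zero_mul])

protected theorem mul_neg (x y : SuperSym V V) : x * -y = -(x * y) :=
  eq_neg_of_add_eq_zero_left (by rw [← mul_add, neg_add_cancel, mul_zero])

/-- Induction principle: a property holding on scalars and generators that is stable under
sums and products holds everywhere. -/
theorem induction {P : SuperSym V V → Prop} (algebraMap : ∀ r, P (algebraMap ℂ _ r))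
    (even : ∀ v, P (even v)) (odd : ∀ w, P (odd w)) (mul : ∀ x y, P x → P y → P (x * y))
    (add : ∀ x y, P x → P y → P (x + y)) (x : SuperSym V V) : P x := by
  induction x using TensorProduct.induction_on with
  | zero => simpa using algebraMap 0
  | add x y hx hy => exact add x y hx hy
  | tmul s y =>
    have hs : P (s ⊗ₜ 1) := by
      induction s using SymmetricAlgebra.induction with
      | algebraMap r => exact algebraMap r
      | ι v => exact even v
      | mul a b ha hb => simpa using mul _ _ ha hb
      | add a b ha hb => simpa [TensorProduct.add_tmul] using add _ _ ha hb
    have hy : P (1 ⊗ₜ y) := by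
      induction y using ExteriorAlgebra.induction with
      | algebraMap r =>
        have := algebraMap r
        rwa [Algebra.TensorProduct.algebraMap_apply'] at this
      | ι v => exact odd v
      | mul a b ha hb => simpa using mul _ _ ha hb
      | add a b ha hb => simpa [TensorProduct.tmul_add] using add _ _ ha hb
    simpa using mul _ _ hs hy

/-- The matrix of an even generator in the representation encoding the Koszul derivation. -/
noncomputable def evenMatrix : V →ₗ[ℂ] Matrix (Fin 2) (Fin 2) (SuperSym V V) where
  toFun v := !![even v, odd v; 0, even v]
  map_add' v w := by simp
  map_smul' r v := by simp [Matrix.smul_of]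

/-- The matrix of an odd generator in the representation encoding the Koszul derivation. -/
noncomputable def oddMatrix : V →ₗ[ℂ] Matrix (Fin 2) (Fin 2) (SuperSym V V) where
  toFun v := !![-odd v, even v; 0, odd v]
  map_add' v w := by simp [add_comm]
  map_smul' r v := by simp [Matrix.smul_of]

theorem evenMatrix_apply (v : V) : evenMatrix v = !![even v, odd v; 0, even v] := rfl

theorem oddMatrix_apply (v : V) : oddMatrix v = !![-odd v, even v; 0, odd v] := rfl

/-- This and the next two results are the defining relations of the superalgebra, checked on
matrices; they let the assignment on generators extend to an algebra map. The sign in `-odd v` makes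
the corner entries match. -/
theorem evenMatrix_commute (v w : V) :
    evenMatrix v * evenMatrix w = evenMatrix w * evenMatrix v := by
  simp [evenMatrix_apply, even_mul_even v w, even_mul_odd, add_comm]

theorem oddMatrix_mul_self (v : V) : oddMatrix v * oddMatrix v = 0 := by
  ext i j
  fin_cases i <;> fin_cases j <;>
    simp [oddMatrix_apply, Matrix.mul_apply, even_mul_odd, odd_mul_self,
      SuperSym.neg_mul, SuperSym.mul_neg]

theorem evenMatrix_mul_oddMatrix (v w : V) :
    evenMatrix v * oddMatrix w = oddMatrix w * evenMatrix v := by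
  simp [evenMatrix_apply, oddMatrix_apply, even_mul_even v w, even_mul_odd, odd_mul_odd v w,
    SuperSym.neg_mul, SuperSym.mul_neg, add_comm]

end koszul

end SuperSym

/-- A linear map into an algebra with pairwise commuting values extends to the symmetric
algebra. -/
theorem SymmetricAlgebra.exists_lift_of_commute {V A : Type*} [AddCommGroup V] [Module ℂ V]
    [Ring A] [Algebra ℂ A] (f : V →ₗ[ℂ] A) (hf : ∀ v w, f v * f w = f w * f v) :
    ∃ F : SymmetricAlgebra ℂ V →ₐ[ℂ] A, ∀ v, F (SymmetricAlgebra.ι ℂ V v) = f v := by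
  have hcomm : ∀ a ∈ Set.range f, ∀ b ∈ Set.range f, a * b = b * a := by
    rintro _ ⟨v, rfl⟩ _ ⟨w, rfl⟩
    exact hf v w
  -- The universal property needs a commutative target, so `f` is corestricted to the subalgebra
  -- generated by its values.
  have := Algebra.isMulCommutative_adjoin ℂ hcomm
  let : CommSemiring (Algebra.adjoin ℂ (Set.range f)) :=
    { (Algebra.adjoin ℂ (Set.range f)).toSemiring with mul_comm := mul_comm' }
  let f' : V →ₗ[ℂ] Algebra.adjoin ℂ (Set.range f) :=
    f.codRestrict (Algebra.adjoin ℂ (Set.range f)).toSubmodule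
      fun v ↦ Algebra.subset_adjoin ⟨v, rfl⟩
  refine ⟨(Algebra.adjoin ℂ (Set.range f)).val.comp (SymmetricAlgebra.lift f'), fun v ↦ ?_⟩
  rw [AlgHom.comp_apply, SymmetricAlgebra.lift_ι_apply]
  rfl

namespace SuperSym

/-! ### The odd derivation, its square and its equivariance -/

section derivation

variable {V : Type*} [AddCommGroup V] [Module ℂ V]

theorem exists_koszulHom : ∃ Φ : SuperSym V V →ₐ[ℂ] Matrix (Fin 2) (Fin 2) (SuperSym V V),
    (∀ v, Φ (even v) = evenMatrix v) ∧ ∀ v, Φ (odd v) = oddMatrix v := by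
  obtain ⟨F, hF⟩ := SymmetricAlgebra.exists_lift_of_commute (evenMatrix (V := V))
    evenMatrix_commute
  let G := ExteriorAlgebra.lift ℂ ⟨oddMatrix (V := V), oddMatrix_mul_self⟩
  have hG (v : V) : G (ExteriorAlgebra.ι ℂ v) = oddMatrix v :=
    ExteriorAlgebra.lift_ι_apply ..
  have hFG (s y) : Commute (F s) (G y) := by
    induction s using SymmetricAlgebra.induction with
    | algebraMap r => rw [AlgHom.commutes]; exact Algebra.commutes _ _
    | mul a b ha hb => rw [map_mul]; exact ha.mul_left hb
    | add a b ha hb => rw [map_add]; exact ha.add_left hb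
    | ι v =>
      induction y using ExteriorAlgebra.induction with
      | algebraMap r => rw [AlgHom.commutes]; exact (Algebra.commutes _ _).symm
      | mul a b ha hb => rw [map_mul]; exact ha.mul_right hb
      | add a b ha hb => rw [map_add]; exact ha.add_right hb
      | ι w => rw [hF, hG]; exact evenMatrix_mul_oddMatrix v w
  exact ⟨Algebra.TensorProduct.lift F G hFG, fun v ↦ by simp [even_apply, hF],
    fun v ↦ by simp [odd_apply, hG]⟩

/-- The algebra map `x ↦ (σ x, D x; 0, x)` where `σ` is the parity automorphism and `D` the
Koszul derivation. -/
noncomputable def koszulHom : SuperSym V V →ₐ[ℂ] Matrix (Fin 2) (Fin 2) (SuperSym V V) :=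
  exists_koszulHom.choose

theorem koszulHom_even (v : V) : koszulHom (even v) = evenMatrix v :=
  exists_koszulHom.choose_spec.1 v

theorem koszulHom_odd (v : V) : koszulHom (odd v) = oddMatrix v :=
  exists_koszulHom.choose_spec.2 v

/-- The odd derivation exchanging the two copies of `V`: the sum of the de Rham and the Koszul
differentials. -/
noncomputable def koszul : SuperSym V V →ₗ[ℂ] SuperSym V V :=
  Matrix.entryLinearMap ℂ _ 0 1 ∘ₗ koszulHom.toLinearMap

/-- The parity automorphism. -/
noncomputable def parity : SuperSym V V →ₗ[ℂ] SuperSym V V :=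
  Matrix.entryLinearMap ℂ _ 0 0 ∘ₗ koszulHom.toLinearMap

theorem koszul_apply (x : SuperSym V V) : koszul x = koszulHom x 0 1 := rfl

theorem parity_apply (x : SuperSym V V) : parity x = koszulHom x 0 0 := rfl

/-- With bottom row (0, x), matrix multiplication makes the (0,0) entry multiplicative and gives the
(0,1) entry a twisted Leibniz rule. -/
theorem koszulHom_one_zero_and_one_one (x : SuperSym V V) :
    koszulHom x 1 0 = 0 ∧ koszulHom x 1 1 = x := by
  induction x using SuperSym.induction with
  | algebraMap r => rw [AlgHom.commutes]; simp [Matrix.algebraMap_matrix_apply]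
  | even v => simp [koszulHom_even, evenMatrix_apply]
  | odd v => simp [koszulHom_odd, oddMatrix_apply]
  | mul x y hx hy => simp [Matrix.mul_apply, hx, hy]
  | add x y hx hy => simp [hx, hy]

theorem parity_mul (x y : SuperSym V V) : parity (x * y) = parity x * parity y := by
  simp [parity_apply, Matrix.mul_apply, koszulHom_one_zero_and_one_one]

theorem koszul_mul (x y : SuperSym V V) :
    koszul (x * y) = koszul x * y + parity x * koszul y := by
  simp [parity_apply, koszul_apply, Matrix.mul_apply, koszulHom_one_zero_and_one_one, add_comm]

theorem parity_even (v : V) : parity (even v) = even v := by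
  simp [parity_apply, koszulHom_even, evenMatrix_apply]

theorem parity_odd (v : V) : parity (odd v) = -odd v := by
  simp [parity_apply, koszulHom_odd, oddMatrix_apply]

theorem parity_algebraMap (r : ℂ) :
    parity (algebraMap ℂ (SuperSym V V) r) = algebraMap ℂ _ r := by
  rw [parity_apply, AlgHom.commutes]
  simp [Matrix.algebraMap_matrix_apply]

theorem koszul_even (v : V) : koszul (even v) = odd v := by
  simp [koszul_apply, koszulHom_even, evenMatrix_apply]

theorem koszul_odd (v : V) : koszul (odd v) = even v := by
  simp [koszul_apply, koszulHom_odd, oddMatrix_apply]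

theorem koszul_algebraMap (r : ℂ) : koszul (algebraMap ℂ (SuperSym V V) r) = 0 := by
  rw [koszul_apply, AlgHom.commutes]
  simp [Matrix.algebraMap_matrix_apply]

theorem parity_parity (x : SuperSym V V) : parity (parity x) = x := by
  induction x using SuperSym.induction with
  | algebraMap r => simp only [parity_algebraMap]
  | even v => simp only [parity_even]
  | odd v => simp only [parity_odd, map_neg, neg_neg]
  | mul x y hx hy => simp only [parity_mul, hx, hy]
  | add x y hx hy => simp only [map_add, hx, hy]

theorem koszul_parity (x : SuperSym V V) : koszul (parity x) = -parity (koszul x) := by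
  induction x using SuperSym.induction with
  | algebraMap r => simp only [parity_algebraMap, koszul_algebraMap, map_zero, neg_zero]
  | even v => simp only [parity_even, koszul_even, parity_odd, neg_neg]
  | odd v => simp only [parity_odd, koszul_odd, parity_even, map_neg]
  | mul x y hx hy =>
    simp only [parity_mul, koszul_mul, hx, hy, map_add, parity_parity, SuperSym.neg_mul,
      SuperSym.mul_neg, neg_add]
  | add x y hx hy => simp only [map_add, hx, hy]; abel

/-- The cross terms σ(Dx)·Dy and D(σx)·Dy cancel because D anticommutes with the parity σ. -/
theorem koszul_koszul_mul (x y : SuperSym V V) :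
    koszul (koszul (x * y)) = koszul (koszul x) * y + x * koszul (koszul y) := by
  simp only [koszul_mul, map_add, koszul_parity, parity_parity, SuperSym.neg_mul]
  abel

theorem act_even {L : Type*} [Group L] (ρ : Representation ℂ L V) (g : L) (v : V) :
    act ρ g (even v) = even (ρ g v) := by
  simp [act, even_apply]

theorem act_odd {L : Type*} [Group L] (ρ : Representation ℂ L V) (g : L) (v : V) :
    act ρ g (odd v) = odd (ρ g v) := by
  simp [act, odd_apply]

theorem act_parity {L : Type*} [Group L] (ρ : Representation ℂ L V) (g : L) (x : SuperSym V V) :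
    act ρ g (parity x) = parity (act ρ g x) := by
  induction x using SuperSym.induction with
  | algebraMap r => simp only [parity_algebraMap, AlgHom.commutes]
  | even v => simp only [parity_even, act_even]
  | odd v => simp only [parity_odd, act_odd, map_neg]
  | mul x y hx hy => simp only [parity_mul, map_mul, hx, hy]
  | add x y hx hy => simp only [map_add, hx, hy]

/-- Both copies of V carry the same representation, so exchanging them is equivariant on generators;
the Leibniz rule does the rest. -/
theorem act_koszul {L : Type*} [Group L] (ρ : Representation ℂ L V) (g : L) (x : SuperSym V V) :
    act ρ g (koszul x) = koszul (act ρ g x) := by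
  induction x using SuperSym.induction with
  | algebraMap r => simp only [koszul_algebraMap, AlgHom.commutes, map_zero]
  | even v => simp only [koszul_even, act_even, act_odd]
  | odd v => simp only [koszul_odd, act_odd, act_even]
  | mul x y hx hy => simp only [koszul_mul, map_mul, map_add, act_parity, hx, hy]
  | add x y hx hy => simp only [map_add, hx, hy]

end derivation

end SuperSym

theorem Submodule.list_ofFn_prod_mem_pow {A : Type*} [Semiring A] [Algebra ℂ A]
    {M : Submodule ℂ A} {a : ℕ} (x : Fin a → A) (h : ∀ r, x r ∈ M) :
    (List.ofFn x).prod ∈ M ^ a := by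
  induction a with
  | zero => simpa using Submodule.one_le.1 (le_refl (1 : Submodule ℂ A))
  | succ a ih =>
    rw [List.ofFn_succ, List.prod_cons, pow_succ']
    exact Submodule.mul_mem_mul (h 0) (ih _ fun r ↦ h r.succ)

namespace SuperSym

/-! ### Multidegrees, injectivity of the derivation, finite dimensionality -/

section component

variable {ι V : Type*} [AddCommGroup V] [Module ℂ V] {𝒱 : (ι →₀ ℕ) → Submodule ℂ V}

/-- Spanning elements become products of lists of generators, so multiplicative facts follow by list
induction. -/
theorem prod_tmul_ιMulti {a b : ℕ} (v : Fin a → V) (w : Fin b → V) :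
    (∏ r, SymmetricAlgebra.ι ℂ V (v r)) ⊗ₜ[ℂ] ExteriorAlgebra.ιMulti ℂ b w =
      (List.ofFn fun r ↦ even (v r)).prod * (List.ofFn fun s ↦ odd (w s)).prod := by
  have h₁ : (List.ofFn fun r ↦ even (v r)).prod =
      (Algebra.TensorProduct.includeLeft : SymmetricAlgebra ℂ V →ₐ[ℂ] SuperSym V V)
        (∏ r, SymmetricAlgebra.ι ℂ V (v r)) := by
    rw [← List.prod_ofFn, map_list_prod, List.map_ofFn]
    rfl
  have h₂ : (List.ofFn fun s ↦ odd (w s)).prod =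
      (Algebra.TensorProduct.includeRight : ExteriorAlgebra ℂ V →ₐ[ℂ] SuperSym V V)
        (ExteriorAlgebra.ιMulti ℂ b w) := by
    rw [ExteriorAlgebra.ιMulti_apply, map_list_prod, List.map_ofFn]
    rfl
  rw [h₁, h₂]
  simp

theorem component_mul_mem {n m n' m' : ι →₀ ℕ} {p p' : ZMod 2} {x y : SuperSym V V}
    (hx : x ∈ component 𝒱 𝒱 n m p) (hy : y ∈ component 𝒱 𝒱 n' m' p') :
    x * y ∈ component 𝒱 𝒱 (n + n') (m + m') (p + p') := by
  have h := Submodule.mul_mem_mul hx hy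
  rw [component, component, Submodule.span_mul_span] at h
  refine Submodule.span_mono ?_ h
  rintro _ ⟨_, ⟨a, b, d, e, v, w, hv, hw, rfl, rfl, rfl, rfl⟩,
    _, ⟨a', b', d', e', v', w', hv', hw', rfl, rfl, rfl, rfl⟩, rfl⟩
  refine ⟨a + a', b + b', Fin.append d d', Fin.append e e', Fin.append v v', Fin.append w w',
    fun r ↦ ?_, fun s ↦ ?_, ?_, ?_, by simp, ?_⟩
  · refine Fin.addCases (fun i ↦ ?_) (fun i ↦ ?_) r
    · simpa using hv i
    · simpa using hv' i
  · refine Fin.addCases (fun i ↦ ?_) (fun i ↦ ?_) s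
    · simpa using hw i
    · simpa using hw' i
  · simp [Fin.sum_univ_add]
  · simp [Fin.sum_univ_add]
  · simp [Fin.prod_univ_add, ← ExteriorAlgebra.ιMulti_mul_ιMulti]

theorem one_mem_component : (1 : SuperSym V V) ∈ component 𝒱 𝒱 0 0 0 :=
  Submodule.subset_span ⟨0, 0, 0, 0, 0, 0, by simp, by simp, by simp, by simp, by simp, by
    simp [Algebra.TensorProduct.one_def]⟩

theorem even_mem_component {d : ι →₀ ℕ} {v : V} (hv : v ∈ 𝒱 d) :
    even v ∈ component 𝒱 𝒱 d 0 0 :=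
  Submodule.subset_span ⟨1, 0, fun _ ↦ d, 0, fun _ ↦ v, 0, by simpa, by simp, by simp, by simp,
    by simp, by simp [even_apply]⟩

theorem odd_mem_component {e : ι →₀ ℕ} {w : V} (hw : w ∈ 𝒱 e) :
    odd w ∈ component 𝒱 𝒱 0 e 1 :=
  Submodule.subset_span ⟨0, 1, 0, fun _ ↦ e, 0, fun _ ↦ w, by simp, by simpa, by simp, by simp,
    by simp, by simp [odd_apply, ExteriorAlgebra.ιMulti_apply]⟩

variable (𝒱) in
/-- The piece of total multidegree `N` and parity `p`. -/
noncomputable def totalComponent (N : ι →₀ ℕ) (p : ZMod 2) : Submodule ℂ (SuperSym V V) :=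
  Submodule.span ℂ {x | ∃ n m, n + m = N ∧ x ∈ component 𝒱 𝒱 n m p}

theorem component_le_totalComponent (n m : ι →₀ ℕ) (p : ZMod 2) :
    component 𝒱 𝒱 n m p ≤ totalComponent 𝒱 (n + m) p :=
  fun _ hx ↦ Submodule.subset_span ⟨n, m, rfl, hx⟩

theorem totalComponent_mul_mem {N M : ι →₀ ℕ} {p q : ZMod 2} {x y : SuperSym V V}
    (hx : x ∈ totalComponent 𝒱 N p) (hy : y ∈ totalComponent 𝒱 M q) :
    x * y ∈ totalComponent 𝒱 (N + M) (p + q) := by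
  have h := Submodule.mul_mem_mul hx hy
  rw [totalComponent, totalComponent, Submodule.span_mul_span] at h
  refine Submodule.span_mono ?_ h
  rintro _ ⟨x, ⟨n, m, rfl, hxm⟩, y, ⟨n', m', rfl, hym⟩, rfl⟩
  exact ⟨n + n', m + m', by abel, component_mul_mem hxm hym⟩

variable (𝒱) in
/-- The element `x` and its parity image are of degree `N` and parity `p`, while its Koszul
derivative is of degree `N` and the opposite parity. -/
structure KoszulCompatible (N : ι →₀ ℕ) (p : ZMod 2) (x : SuperSym V V) : Prop where
  mem : x ∈ totalComponent 𝒱 N p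
  parity_mem : parity x ∈ totalComponent 𝒱 N p
  koszul_mem : koszul x ∈ totalComponent 𝒱 N (p + 1)

/-- The parity image has to be tracked because D(xy) = Dx·y + σx·Dy contains σx. -/
theorem KoszulCompatible.mul {N M : ι →₀ ℕ} {p q : ZMod 2} {x y : SuperSym V V}
    (hx : KoszulCompatible 𝒱 N p x) (hy : KoszulCompatible 𝒱 M q y) :
    KoszulCompatible 𝒱 (N + M) (p + q) (x * y) where
  mem := totalComponent_mul_mem hx.mem hy.mem
  parity_mem := by
    rw [parity_mul]
    exact totalComponent_mul_mem hx.parity_mem hy.parity_mem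
  koszul_mem := by
    rw [koszul_mul]
    refine add_mem ?_ ?_
    · rw [add_right_comm]
      exact totalComponent_mul_mem hx.koszul_mem hy.mem
    · rw [add_assoc]
      exact totalComponent_mul_mem hx.parity_mem hy.koszul_mem

theorem koszulCompatible_one : KoszulCompatible 𝒱 0 0 1 where
  mem := by simpa using component_le_totalComponent (𝒱 := 𝒱) 0 0 0 one_mem_component
  parity_mem := by
    have h := parity_algebraMap (V := V) 1
    rw [map_one] at h
    simpa [h] using component_le_totalComponent (𝒱 := 𝒱) 0 0 0 one_mem_component
  koszul_mem := by
    have h := koszul_algebraMap (V := V) 1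
    rw [map_one] at h
    simp [h]

theorem koszulCompatible_even {d : ι →₀ ℕ} {v : V} (hv : v ∈ 𝒱 d) :
    KoszulCompatible 𝒱 d 0 (even v) where
  mem := by simpa using component_le_totalComponent _ _ _ (even_mem_component hv)
  parity_mem := by
    simpa [parity_even] using component_le_totalComponent _ _ _ (even_mem_component hv)
  koszul_mem := by
    simpa [koszul_even] using component_le_totalComponent _ _ _ (odd_mem_component hv)

theorem koszulCompatible_odd {d : ι →₀ ℕ} {v : V} (hv : v ∈ 𝒱 d) :
    KoszulCompatible 𝒱 d 1 (odd v) where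
  mem := by simpa using component_le_totalComponent _ _ _ (odd_mem_component hv)
  parity_mem := by
    simpa [parity_odd] using component_le_totalComponent _ _ _ (odd_mem_component hv)
  koszul_mem := by
    have h : (1 + 1 : ZMod 2) = 0 := by decide
    simpa [koszul_odd, h] using component_le_totalComponent _ _ _ (even_mem_component hv)

theorem KoszulCompatible.list_prod {a : ℕ} (d : Fin a → ι →₀ ℕ) (p : Fin a → ZMod 2)
    (x : Fin a → SuperSym V V) (h : ∀ r, KoszulCompatible 𝒱 (d r) (p r) (x r)) :
    KoszulCompatible 𝒱 (∑ r, d r) (∑ r, p r) (List.ofFn x).prod := by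
  induction a with
  | zero => simpa using koszulCompatible_one
  | succ a ih =>
    rw [Fin.sum_univ_succ, Fin.sum_univ_succ, List.ofFn_succ, List.prod_cons]
    exact (h 0).mul (ih _ _ _ fun r ↦ h r.succ)

/-- D trades one factor for its twin of the same degree in the other copy, so only the sum n + m
survives. -/
theorem koszul_mem_of_mem_component {n m : ι →₀ ℕ} {p : ZMod 2} {x : SuperSym V V}
    (hx : x ∈ component 𝒱 𝒱 n m p) : koszul x ∈ totalComponent 𝒱 (n + m) (p + 1) := by
  induction hx using Submodule.span_induction with
  | zero => simp
  | add x y _ _ hx hy => rw [map_add]; exact add_mem hx hy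
  | smul r x _ hx => rw [map_smul]; exact Submodule.smul_mem _ _ hx
  | mem x hx =>
    obtain ⟨a, b, d, e, v, w, hv, hw, rfl, rfl, rfl, rfl⟩ := hx
    rw [prod_tmul_ιMulti]
    have h₁ := KoszulCompatible.list_prod d 0 _ fun r ↦ koszulCompatible_even (hv r)
    have h₂ := KoszulCompatible.list_prod e 1 _ fun r ↦ koszulCompatible_odd (hw r)
    simpa using (h₁.mul h₂).koszul_mem

theorem koszul_mem_totalComponent {N : ι →₀ ℕ} {p : ZMod 2} {x : SuperSym V V}
    (hx : x ∈ totalComponent 𝒱 N p) : koszul x ∈ totalComponent 𝒱 N (p + 1) := by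
  induction hx using Submodule.span_induction with
  | zero => simp
  | add x y _ _ hx hy => rw [map_add]; exact add_mem hx hy
  | smul r x _ hx => rw [map_smul]; exact Submodule.smul_mem _ _ hx
  | mem x hx =>
    obtain ⟨n, m, rfl, hx⟩ := hx
    exact koszul_mem_of_mem_component hx

theorem koszul_koszul_list_prod (l : List (SuperSym V V))
    (hl : ∀ x ∈ l, koszul (koszul x) = x) :
    koszul (koszul l.prod) = (l.length : ℂ) • l.prod := by
  induction l with
  | nil =>
    have h := koszul_algebraMap (V := V) 1
    rw [map_one] at h
    simp [h]
  | cons x l ih =>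
    rw [List.prod_cons, koszul_koszul_mul, hl x (by simp), ih fun y hy ↦ hl y (by simp [hy]),
      mul_smul_comm, List.length_cons, Nat.cast_add, Nat.cast_one, add_smul, one_smul, add_comm]

theorem koszul_koszul_tmul {a b : ℕ} (v : Fin a → V) (w : Fin b → V) :
    koszul (koszul ((∏ r, SymmetricAlgebra.ι ℂ V (v r)) ⊗ₜ[ℂ] ExteriorAlgebra.ιMulti ℂ b w)) =
      ((a + b : ℕ) : ℂ) •
        ((∏ r, SymmetricAlgebra.ι ℂ V (v r)) ⊗ₜ[ℂ] ExteriorAlgebra.ιMulti ℂ b w) := by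
  rw [prod_tmul_ιMulti, ← List.prod_append, koszul_koszul_list_prod]
  · simp
  · simp only [List.mem_append, List.mem_ofFn]
    rintro _ (⟨r, rfl⟩ | ⟨s, rfl⟩)
    · rw [koszul_even, koszul_odd]
    · rw [koszul_odd, koszul_even]

/-- The square of the Koszul derivation. -/
noncomputable def euler : Module.End ℂ (SuperSym V V) := koszul ∘ₗ koszul

/-- The number of factors is not determined by N, so several eigenvalues may occur; zero is excluded
since the empty product has degree 0. -/
theorem totalComponent_le_iSup_eigenspace {N : ι →₀ ℕ} (hN : N ≠ 0) (p : ZMod 2) :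
    totalComponent 𝒱 N p ≤ ⨆ (c : ℂ) (_ : c ≠ 0), (euler (V := V)).eigenspace c := by
  refine Submodule.span_le.2 ?_
  rintro x ⟨n, m, rfl, hx⟩
  refine (Submodule.span_le.2 ?_ : component 𝒱 𝒱 n m p ≤ _) hx
  rintro _ ⟨a, b, d, e, v, w, -, -, rfl, rfl, -, rfl⟩
  have hab : ((a + b : ℕ) : ℂ) ≠ 0 := by
    rw [Nat.cast_ne_zero]
    intro h
    obtain ⟨rfl, rfl⟩ := Nat.add_eq_zero_iff.1 h
    simp at hN
  exact Submodule.mem_iSup_of_mem _ (Submodule.mem_iSup_of_mem hab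
    (Module.End.mem_eigenspace_iff.2 (koszul_koszul_tmul v w)))

/-- The kernel of D lies in the 0-eigenspace of D², which is independent of the other eigenspaces.
-/
theorem eq_zero_of_koszul_eq_zero {N : ι →₀ ℕ} (hN : N ≠ 0) {p : ZMod 2} {x : SuperSym V V}
    (hx : x ∈ totalComponent 𝒱 N p) (h : koszul x = 0) : x = 0 :=
  Submodule.disjoint_def.1 ((euler (V := V)).eigenspaces_iSupIndep 0) x
    (Module.End.mem_eigenspace_iff.2 (by simp [euler, h]))
    (totalComponent_le_iSup_eigenspace hN p hx)

theorem component_zero_le_span_one (h_zero : 𝒱 0 = ⊥) (p : ZMod 2) :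
    component 𝒱 𝒱 0 0 p ≤ if p = 0 then Submodule.span ℂ {1} else ⊥ := by
  refine Submodule.span_le.2 ?_
  rintro _ ⟨a, b, d, e, v, w, hv, hw, hd, he, rfl, rfl⟩
  rw [Finset.sum_eq_zero_iff] at hd he
  replace hv (r) : v r = 0 := by simpa [hd r, h_zero] using hv r
  replace hw (r) : w r = 0 := by simpa [he r, h_zero] using hw r
  rcases a with _ | a
  · rcases b with _ | b
    · simp [Algebra.TensorProduct.one_def, Submodule.mem_span_singleton_self]
    · rw [(ExteriorAlgebra.ιMulti ℂ (b + 1)).map_coord_zero 0 (hw 0), TensorProduct.tmul_zero]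
      exact zero_mem _
  · rw [Fin.prod_univ_succ, hv 0, map_zero, zero_mul, TensorProduct.zero_tmul]
    exact zero_mem _

/-- The augmentation maps the algebra onto ℂ. This ensures that the line of constants has dimension
1. -/
instance : Nontrivial (SuperSym V V) :=
  (Algebra.TensorProduct.lift (SymmetricAlgebra.algebraMapInv (R := ℂ) (M := V))
    (ExteriorAlgebra.algebraMapInv (R := ℂ) (M := V))
    fun _ _ ↦ Commute.all _ _).toRingHom.domain_nontrivial

/-- A nonzero product has no factor of degree zero, so its length is bounded by the total degree,
and its factors come from the finitely many pieces of degree at most n or m. -/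
theorem finiteDimensional_component (h_fin : ∀ n, FiniteDimensional ℂ (𝒱 n)) (h_zero : 𝒱 0 = ⊥)
    (n m : ι →₀ ℕ) (p : ZMod 2) : FiniteDimensional ℂ (component 𝒱 𝒱 n m p) := by
  classical
  let U (k : ι →₀ ℕ) : Submodule ℂ V := ⨆ d ∈ Finset.Iic k, 𝒱 d
  have hU (k) : (U k).FG := Submodule.fg_biSup _ _ fun d _ ↦
    (Submodule.fg_iff_finiteDimensional _).2 (h_fin d)
  let W : Submodule ℂ (SuperSym V V) := ⨆ ab ∈ Finset.Iic n.degree ×ˢ Finset.Iic m.degree,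
    (U n).map even ^ ab.1 * (U m).map odd ^ ab.2
  have hW : W.FG := Submodule.fg_biSup _ _ fun ab _ ↦
    (((hU n).map _).pow _).mul (((hU m).map _).pow _)
  have : FiniteDimensional ℂ W := (Submodule.fg_iff_finiteDimensional _).1 hW
  refine Submodule.finiteDimensional_of_le (S₂ := W) (Submodule.span_le.2 ?_)
  have card_le {a : ℕ} {d : Fin a → ι →₀ ℕ} (h : ∀ r, d r ≠ 0) : a ≤ (∑ r, d r).degree := by
    rw [map_sum]
    calc a = ∑ _r : Fin a, 1 := by simp
      _ ≤ _ := Finset.sum_le_sum fun r _ ↦ Nat.one_le_iff_ne_zero.2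
        ((Finsupp.degree_eq_zero_iff _).not.2 (h r))
  have mem_U {a : ℕ} {d : Fin a → ι →₀ ℕ} {v : Fin a → V} (h : ∀ r, v r ∈ 𝒱 (d r)) (r) :
      v r ∈ U (∑ r, d r) :=
    Submodule.mem_iSup_of_mem (d r) (Submodule.mem_iSup_of_mem
      (Finset.mem_Iic.2 (Finset.single_le_sum (fun _ _ ↦ zero_le) (Finset.mem_univ r))) (h r))
  rintro _ ⟨a, b, d, e, v, w, hv, hw, rfl, rfl, rfl, rfl⟩
  by_cases hd : ∃ r, d r = 0
  · obtain ⟨r, hr⟩ := hd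
    have : v r = 0 := by simpa [hr, h_zero] using hv r
    rw [Finset.prod_eq_zero (Finset.mem_univ r) (by rw [this, map_zero]),
      TensorProduct.zero_tmul]
    exact zero_mem _
  by_cases he : ∃ r, e r = 0
  · obtain ⟨r, hr⟩ := he
    have : w r = 0 := by simpa [hr, h_zero] using hw r
    rw [(ExteriorAlgebra.ιMulti ℂ b).map_coord_zero r this, TensorProduct.tmul_zero]
    exact zero_mem _
  push Not at hd he
  rw [prod_tmul_ιMulti]
  refine Submodule.mem_iSup_of_mem (a, b) (Submodule.mem_iSup_of_mem ?_
    (Submodule.mul_mem_mul (Submodule.list_ofFn_prod_mem_pow _ fun r ↦ ?_)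
      (Submodule.list_ofFn_prod_mem_pow _ fun r ↦ ?_)))
  · exact Finset.mem_product.2 ⟨Finset.mem_Iic.2 (card_le hd), Finset.mem_Iic.2 (card_le he)⟩
  · exact Submodule.mem_map_of_mem (mem_U hv r)
  · exact Submodule.mem_map_of_mem (mem_U hw r)

end component

end SuperSym

namespace SuperSym

/-! ### Independence of the bigraded pieces -/

section independence

variable {ι V : Type*} [AddCommGroup V] [Module ℂ V]
  {𝒱 : (ι →₀ ℕ) → Submodule ℂ V}

/-- A graded space carries commuting operators whose joint eigenvalues recover the degree. -/
theorem exists_scale [DecidableEq ι] (h : DirectSum.IsInternal 𝒱) :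
    ∃ s : ι → V →ₗ[ℂ] V, (∀ i n, ∀ v ∈ 𝒱 n, s i v = (2 ^ n i : ℂ) • v) ∧
      ∀ i j v, s i (s j v) = s j (s i v) := by
  let e := LinearEquiv.ofBijective (DirectSum.coeLinearMap 𝒱) h
  let s (i : ι) : V →ₗ[ℂ] V :=
    DirectSum.toModule ℂ _ V (fun n ↦ (2 ^ n i : ℂ) • (𝒱 n).subtype) ∘ₗ e.symm.toLinearMap
  have hs (i n) (v : V) (hv : v ∈ 𝒱 n) : s i v = (2 ^ n i : ℂ) • v := by
    have : e.symm v = DirectSum.lof ℂ _ (fun n ↦ 𝒱 n) n ⟨v, hv⟩ := by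
      rw [LinearEquiv.symm_apply_eq]
      exact (DirectSum.coeLinearMap_lof 𝒱 n ⟨v, hv⟩).symm
    simp [s, this]
  refine ⟨s, hs, fun i j v ↦ ?_⟩
  have hv : v ∈ ⨆ n, 𝒱 n := by simp [h.submodule_iSup_eq_top]
  induction hv using Submodule.iSup_induction' with
  | mem n v hv => simp [hs _ n v hv, smul_smul, mul_comm]
  | zero => simp
  | add v w _ _ hv hw => simp [hv, hw]

/-- The operator scaling the odd generators. -/
noncomputable def oddMap (f : V →ₗ[ℂ] V) : SuperSym V V →ₐ[ℂ] SuperSym V V :=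
  Algebra.TensorProduct.map (AlgHom.id ℂ _) (ExteriorAlgebra.map f)

theorem oddMap_tmul (f : V →ₗ[ℂ] V) (s : SymmetricAlgebra ℂ V) {b : ℕ} (w : Fin b → V) :
    oddMap f (s ⊗ₜ ExteriorAlgebra.ιMulti ℂ b w) =
      s ⊗ₜ ExteriorAlgebra.ιMulti ℂ b fun r ↦ f (w r) := by
  simp [oddMap, ExteriorAlgebra.map_apply_ιMulti, Function.comp_def]

theorem oddMap_comm {f g : V →ₗ[ℂ] V} (h : ∀ v, f (g v) = g (f v)) (x : SuperSym V V) :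
    oddMap f (oddMap g x) = oddMap g (oddMap f x) := by
  induction x using SuperSym.induction with
  | algebraMap r => simp only [AlgHom.commutes]
  | even v => simp [oddMap, even_apply]
  | odd v => simp [oddMap, odd_apply, h]
  | mul x y hx hy => simp only [map_mul, hx, hy]
  | add x y hx hy => simp only [map_add, hx, hy]

/-- Eigenvalues multiply along a wedge product, so the powers of 2 turn into addition of degrees. -/
theorem oddMap_apply_of_mem_component {i : ι} {f : V →ₗ[ℂ] V}
    (hf : ∀ n, ∀ v ∈ 𝒱 n, f v = (2 ^ n i : ℂ) • v) {n m : ι →₀ ℕ} {p : ZMod 2}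
    {x : SuperSym V V} (hx : x ∈ component 𝒱 𝒱 n m p) :
    oddMap f x = (2 ^ m i : ℂ) • x := by
  induction hx using Submodule.span_induction with
  | zero => simp only [map_zero, smul_zero]
  | add x y _ _ hx hy => rw [map_add, hx, hy, smul_add]
  | smul r x _ hx => rw [map_smul, hx, smul_comm]
  | mem x hx =>
    obtain ⟨a, b, d, e, v, w, hv, hw, rfl, rfl, rfl, rfl⟩ := hx
    rw [oddMap_tmul, funext fun r ↦ hf _ _ (hw r)]
    have h := (ExteriorAlgebra.ιMulti ℂ b (M := V)).toMultilinearMap.map_smul_univ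
      (fun r ↦ (2 ^ e r i : ℂ)) w
    simp only [AlternatingMap.coe_multilinearMap, Finset.prod_pow_eq_pow_sum] at h
    rw [h, TensorProduct.tmul_smul, Finsupp.finsetSum_apply]

/-- The pieces lie in joint eigenspaces of commuting operators with eigenvalues 2 ^ m i. These
determine m, and then n because n + m = N; scaling the odd generators alone therefore suffices. -/
theorem iSupIndep_component [DecidableEq ι] (h : DirectSum.IsInternal 𝒱) (N : ι →₀ ℕ) (p : ZMod 2) :
    iSupIndep fun x : Finset.HasAntidiagonal.antidiagonal N ↦ component 𝒱 𝒱 x.1.1 x.1.2 p := by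
  obtain ⟨s, hs, hcomm⟩ := exists_scale h
  let T (i : ι) : Module.End ℂ (SuperSym V V) := (oddMap (s i)).toLinearMap
  have hT : iSupIndep fun χ : ι → ℂ ↦ ⨅ i, (T i).maxGenEigenspace (χ i) :=
    Module.End.independent_iInf_maxGenEigenspace_of_forall_mapsTo T fun i j φ ↦
      Module.End.mapsTo_maxGenEigenspace_of_comm (LinearMap.ext fun x ↦ oddMap_comm (hcomm j i) x) φ
  have hinj : Function.Injective
      fun (x : Finset.HasAntidiagonal.antidiagonal N) (i : ι) ↦ (2 ^ x.1.2 i : ℂ) := by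
    rintro ⟨⟨n, m⟩, hx⟩ ⟨⟨n', m'⟩, hy⟩ hxy
    rw [Finset.HasAntidiagonal.mem_antidiagonal] at hx hy
    obtain rfl : m = m' := Finsupp.ext fun i ↦ by
      have h2 : ((2 ^ m i : ℕ) : ℂ) = ((2 ^ m' i : ℕ) : ℂ) := by
        simpa using congrFun hxy i
      exact Nat.pow_right_injective le_rfl (Nat.cast_injective h2)
    obtain rfl : n = n' := add_right_cancel (hx.trans hy.symm)
    rfl
  refine (hT.comp hinj).mono fun x y hy ↦ ?_
  simp only [Function.comp_apply, Submodule.mem_iInf]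
  exact fun i ↦ ((T i).genEigenspace _).mono le_top (Module.End.mem_eigenspace_iff.2
    (oddMap_apply_of_mem_component (hs i) hy))

end independence

/-! ### Group action on the pieces -/

section action

variable {ι V L : Type*} [AddCommGroup V] [Module ℂ V] [Group L]
  {𝒱 : (ι →₀ ℕ) → Submodule ℂ V} {ρ : Representation ℂ L V}

theorem mem_invariants {x : SuperSym V V} : x ∈ invariants ρ ↔ ∀ g, act ρ g x = x := by
  simp [invariants, Algebra.mem_iInf, AlgHom.mem_equalizer]

theorem act_mem_component (h_stable : ∀ g n, ∀ v ∈ 𝒱 n, ρ g v ∈ 𝒱 n) (g : L)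
    {n m : ι →₀ ℕ} {p : ZMod 2} {x : SuperSym V V} (hx : x ∈ component 𝒱 𝒱 n m p) :
    act ρ g x ∈ component 𝒱 𝒱 n m p := by
  suffices component 𝒱 𝒱 n m p ≤ (component 𝒱 𝒱 n m p).comap (act ρ g).toLinearMap from this hx
  refine Submodule.span_le.2 ?_
  rintro _ ⟨a, b, d, e, v, w, hv, hw, rfl, rfl, rfl, rfl⟩
  refine Submodule.subset_span ⟨a, b, d, e, fun r ↦ ρ g (v r), fun r ↦ ρ g (w r),
    fun r ↦ h_stable _ _ _ (hv r), fun r ↦ h_stable _ _ _ (hw r), rfl, rfl, rfl, ?_⟩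
  simp [act, ExteriorAlgebra.map_apply_ιMulti, Function.comp_def]

end action

end SuperSym

/-! ### Dimensions of independent sums and the substitution u = t -/

theorem finrank_iSup_of_iSupIndep {κ W : Type*} [Fintype κ] [AddCommGroup W] [Module ℂ W]
    {p : κ → Submodule ℂ W} (h : iSupIndep p) [∀ i, FiniteDimensional ℂ (p i)] :
    Module.finrank ℂ (⨆ i, p i : Submodule ℂ W) = ∑ i, Module.finrank ℂ (p i) := by
  classical
  rw [Submodule.iSup_eq_range_dfinsupp_lsum, LinearMap.finrank_range_of_inj
    h.dfinsupp_lsum_injective]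
  exact Module.finrank_directSum ℂ fun i ↦ p i

theorem Finsupp.mapDomain_sumElim_id {ι : Type*} (c : ι ⊕ ι →₀ ℕ) :
    c.mapDomain (Sum.elim id id) =
      (sumFinsuppEquivProdFinsupp c).1 + (sumFinsuppEquivProdFinsupp c).2 := by
  classical
  induction c using Finsupp.induction_linear with
  | zero => ext; simp
  | add f g hf hg =>
    rw [mapDomain_add, hf, hg]
    ext
    simp
    abel
  | single x k =>
    rw [mapDomain_single]
    ext i
    rcases x with x | x <;> simp [single_apply]

theorem coeff_identifyVars_superIndex {ι W : Type*} [DecidableEq ι] [AddCommGroup W] [Module ℂ W]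
    (𝒲 : (ι →₀ ℕ) → (ι →₀ ℕ) → ZMod 2 → Submodule ℂ W) (N : ι →₀ ℕ) :
    (identifyVars ι (superIndex 𝒲)).coeff N = ∑ x ∈ Finset.HasAntidiagonal.antidiagonal N,
      ((Module.finrank ℂ (𝒲 x.1 x.2 0) : ℤ) - Module.finrank ℂ (𝒲 x.1 x.2 1)) := by
  rw [identifyVars, MvPowerSeries.coeff_rename]
  refine Finset.sum_equiv Finsupp.sumFinsuppEquivProdFinsupp (fun c ↦ ?_) fun c _ ↦ rfl
  simp [Finsupp.mapDomain_sumElim_id]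

namespace SuperSym

section finiteDimensional

variable {ι V L : Type*} [AddCommGroup V] [Module ℂ V] [Group L]
  {𝒱 : (ι →₀ ℕ) → Submodule ℂ V} {ρ : Representation ℂ L V}

theorem finiteDimensional_invComponent (h_fin : ∀ n, FiniteDimensional ℂ (𝒱 n))
    (h_zero : 𝒱 0 = ⊥) (n m : ι →₀ ℕ) (p : ZMod 2) :
    FiniteDimensional ℂ (invComponent 𝒱 ρ n m p) :=
  have := finiteDimensional_component h_fin h_zero n m p
  Submodule.finiteDimensional_of_le (S₂ := component 𝒱 𝒱 n m p) inf_le_left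

end finiteDimensional

/-! ### Even and odd invariants of a fixed total degree -/

section index

variable {ι V L : Type*} [DecidableEq ι] [AddCommGroup V] [Module ℂ V] [Group L]
  {𝒱 : (ι →₀ ℕ) → Submodule ℂ V} {ρ : Representation ℂ L V}

variable (𝒱 ρ) in
/-- The invariants of total multidegree `N` and parity `p`. -/
noncomputable def totalInvComponent (N : ι →₀ ℕ) (p : ZMod 2) : Submodule ℂ (SuperSym V V) :=
  ⨆ x : Finset.HasAntidiagonal.antidiagonal N, invComponent 𝒱 ρ x.1.1 x.1.2 p

/-- L preserves each bigraded piece, so by uniqueness of the decomposition every component of an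
invariant element is invariant. -/
theorem mem_totalInvComponent (h_graded : DirectSum.IsInternal 𝒱)
    (h_stable : ∀ g n, ∀ v ∈ 𝒱 n, ρ g v ∈ 𝒱 n) {N : ι →₀ ℕ} {p : ZMod 2} {x : SuperSym V V} :
    x ∈ totalInvComponent 𝒱 ρ N p ↔ x ∈ totalComponent 𝒱 N p ∧ ∀ g, act ρ g x = x := by
  constructor
  · suffices totalInvComponent 𝒱 ρ N p ≤
        totalComponent 𝒱 N p ⊓ Subalgebra.toSubmodule (invariants ρ) from
      fun hx ↦ ⟨(this hx).1, mem_invariants.1 (this hx).2⟩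
    refine iSup_le fun y ↦ inf_le_inf_right _ ?_
    have h := component_le_totalComponent (𝒱 := 𝒱) y.1.1 y.1.2 p
    rwa [Finset.HasAntidiagonal.mem_antidiagonal.1 y.2] at h
  · rintro ⟨hx, hinv⟩
    have hle : totalComponent 𝒱 N p ≤
        ⨆ y : Finset.HasAntidiagonal.antidiagonal N, component 𝒱 𝒱 y.1.1 y.1.2 p := by
      refine Submodule.span_le.2 ?_
      rintro z ⟨n, m, h, hz⟩
      exact Submodule.mem_iSup_of_mem
        (⟨(n, m), Finset.HasAntidiagonal.mem_antidiagonal.2 h⟩ :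
          Finset.HasAntidiagonal.antidiagonal N) hz
    obtain ⟨f, hf, rfl⟩ := (Submodule.mem_iSup_iff_exists_finsupp _ _).1 (hle hx)
    have hfix (g : L) : ∀ i ∈ f.support, act ρ g (f i) = f i := by
      refine (iSupIndep_iff_finsetSum_eq_imp_eq _).1 (iSupIndep_component h_graded N p)
        f.support (fun i ↦ act ρ g (f i)) f
        (fun i _ ↦ ⟨act_mem_component h_stable g (hf i), hf i⟩) ?_
      rw [← map_sum]
      exact hinv g
    exact Submodule.sum_mem _ fun i hi ↦ Submodule.mem_iSup_of_mem i
      ⟨hf i, mem_invariants.2 fun g ↦ hfix g i hi⟩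

theorem finrank_totalInvComponent (h_graded : DirectSum.IsInternal 𝒱)
    (h_fin : ∀ n, FiniteDimensional ℂ (𝒱 n)) (h_zero : 𝒱 0 = ⊥) (N : ι →₀ ℕ) (p : ZMod 2) :
    Module.finrank ℂ (totalInvComponent 𝒱 ρ N p) =
      ∑ x ∈ Finset.HasAntidiagonal.antidiagonal N,
        Module.finrank ℂ (invComponent 𝒱 ρ x.1 x.2 p) := by
  have := finiteDimensional_invComponent (ρ := ρ) h_fin h_zero
  rw [← Finset.sum_coe_sort]
  exact finrank_iSup_of_iSupIndep ((iSupIndep_component h_graded N p).mono fun x ↦ inf_le_left)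

/-- D restricts to an injection between these spaces of invariants. -/
theorem finrank_totalInvComponent_le (h_graded : DirectSum.IsInternal 𝒱)
    (h_fin : ∀ n, FiniteDimensional ℂ (𝒱 n)) (h_zero : 𝒱 0 = ⊥)
    (h_stable : ∀ g n, ∀ v ∈ 𝒱 n, ρ g v ∈ 𝒱 n) {N : ι →₀ ℕ} (hN : N ≠ 0) (p : ZMod 2) :
    Module.finrank ℂ (totalInvComponent 𝒱 ρ N p) ≤
      Module.finrank ℂ (totalInvComponent 𝒱 ρ N (p + 1)) := by
  have := finiteDimensional_invComponent (ρ := ρ) h_fin h_zero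
  have : FiniteDimensional ℂ (totalInvComponent 𝒱 ρ N (p + 1)) :=
    Submodule.finiteDimensional_iSup _
  have hmem (x) (hx : x ∈ totalInvComponent 𝒱 ρ N p) :
      koszul x ∈ totalInvComponent 𝒱 ρ N (p + 1) := by
    rw [mem_totalInvComponent h_graded h_stable] at hx ⊢
    exact ⟨koszul_mem_totalComponent hx.1, fun g ↦ by rw [act_koszul, hx.2]⟩
  refine LinearMap.finrank_le_finrank_of_injective (f := koszul.restrict hmem)
    ((injective_iff_map_eq_zero _).2 fun x hx ↦ Subtype.ext ?_)
  exact eq_zero_of_koszul_eq_zero hN ((mem_totalInvComponent h_graded h_stable).1 x.2).1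
    (congrArg Subtype.val hx)

theorem finrank_totalInvComponent_zero_eq_one (h_graded : DirectSum.IsInternal 𝒱)
    (h_fin : ∀ n, FiniteDimensional ℂ (𝒱 n)) (h_zero : 𝒱 0 = ⊥)
    (h_stable : ∀ g n, ∀ v ∈ 𝒱 n, ρ g v ∈ 𝒱 n) {N : ι →₀ ℕ} (hN : N ≠ 0) :
    Module.finrank ℂ (totalInvComponent 𝒱 ρ N 0) =
      Module.finrank ℂ (totalInvComponent 𝒱 ρ N 1) := by
  refine le_antisymm ?_ ?_
  · have h := finrank_totalInvComponent_le (ρ := ρ) h_graded h_fin h_zero h_stable hN 0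
    rwa [zero_add] at h
  · have h := finrank_totalInvComponent_le (ρ := ρ) h_graded h_fin h_zero h_stable hN 1
    rwa [show (1 + 1 : ZMod 2) = 0 by decide] at h

end index

/-! ### Invariants of degree zero -/

section degreeZero

variable {ι V L : Type*} [AddCommGroup V] [Module ℂ V] [Group L]
  {𝒱 : (ι →₀ ℕ) → Submodule ℂ V} {ρ : Representation ℂ L V}

theorem invComponent_zero_zero_zero (h_zero : 𝒱 0 = ⊥) :
    invComponent 𝒱 ρ 0 0 0 = Submodule.span ℂ {1} := by
  refine le_antisymm (inf_le_left.trans ?_) ?_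
  · simpa using component_zero_le_span_one h_zero 0
  · rw [Submodule.span_singleton_le_iff_mem]
    exact ⟨one_mem_component, one_mem (invariants ρ)⟩

theorem invComponent_zero_zero_one (h_zero : 𝒱 0 = ⊥) : invComponent 𝒱 ρ 0 0 1 = ⊥ :=
  le_bot_iff.1 (inf_le_left.trans (by simpa using component_zero_le_span_one h_zero 1))

end degreeZero

end SuperSym

theorem mainTheorem9
    {E : Type*} [NormedAddCommGroup E] [NormedSpace ℝ E] [FiniteDimensional ℝ E]
    {H : Type*} [TopologicalSpace H] (I : ModelWithCorners ℝ E H) [I.Boundaryless]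
    {L : Type*} [Group L] [TopologicalSpace L] [ChartedSpace H L] [LieGroup I ∞ L]
    [CompactSpace L] [T2Space L]
    {ι : Type*} [DecidableEq ι]
    {V : Type*} [AddCommGroup V] [Module ℂ V]
    (𝒱 : (ι →₀ ℕ) → Submodule ℂ V) (h_graded : DirectSum.IsInternal 𝒱)
    (h_fin : ∀ n, FiniteDimensional ℂ (𝒱 n)) (h_zero : 𝒱 0 = ⊥)
    (ρ : Representation ℂ L V) (h_stable : ∀ g n, ∀ v ∈ 𝒱 n, ρ g v ∈ 𝒱 n)
    (h_cont : ∀ (φ : Module.Dual ℂ V) (v : V), Continuous fun g : L ↦ φ (ρ g v)) :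
    (∀ n m p, FiniteDimensional ℂ (SuperSym.invComponent 𝒱 ρ n m p)) ∧
      identifyVars ι (superIndex (SuperSym.invComponent 𝒱 ρ)) = 1 := by
  refine ⟨SuperSym.finiteDimensional_invComponent h_fin h_zero, MvPowerSeries.ext fun N ↦ ?_⟩
  rw [coeff_identifyVars_superIndex, MvPowerSeries.coeff_one]
  split_ifs with hN
  -- The only pair is (0, 0), where the constants contribute 1 - 0.
  · subst hN
    rw [Finset.HasAntidiagonal.antidiagonal_zero, Finset.sum_singleton,
      SuperSym.invComponent_zero_zero_zero h_zero, SuperSym.invComponent_zero_zero_one h_zero,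
      finrank_span_singleton one_ne_zero, finrank_bot]
    rfl
  · rw [Finset.sum_sub_distrib, ← Nat.cast_sum, ← Nat.cast_sum,
      ← SuperSym.finrank_totalInvComponent h_graded h_fin h_zero,
      ← SuperSym.finrank_totalInvComponent h_graded h_fin h_zero,
      SuperSym.finrank_totalInvComponent_zero_eq_one h_graded h_fin h_zero h_stable hN, sub_self]
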